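/- Let $U$ be a countable set (with the discrete $\sigma$-algebra), let $\mathcal C=(L_1,L_2,\dots)$ be a sequence of non-empty subsets of $U$ (languages; repetitions are allowed), let $k\in\mathbb N$ and $p\in[0,1]$. A list $\mu=(i_1,\dots,i_k)\in\mathbb N^k$ is said to identify a language $L$ if $L_{i_j}=L$ for some $j\in\{1,\dots,k\}$. An enumeration of $L$ is a sequence $x_1,x_2,\dots$ of elements of $L$ in which every element of $L$ occurs. A probability distribution $\mathcal D$ on $U$ is valid for $L$ if, for all $x\in U$, $\mathcal D(x)>0$ if and only if $x\in L$. (a) $\mathcal C$ is *$k$-list identifiable in the limit with probability $p$ on infinite draws* if there is a function $\mathcal A':U^*\to\mathbb N^k$ such that for every $z$ and every distribution $\mathcal D$ that is valid for $L_z$, with probability at least $p$ over an infinite i.i.d. sequence $(x_i)_{i\in\mathbb N}\sim\mathcal D^\infty$, there is a finite $t^\star$ such that for all $t\ge t^\star$ the list $\mathcal A'(x_1,\dots,x_t)$ identifies $L_z$. (b) $\mathcal C$ is *probabilistically $k$-list identifiable in the limit with probability $p$* if there is a function $\mathcal A:(U\times\{0,1\})^*\to\mathbb N^k$ such that for every $z$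 and every enumeration $x_1,x_2,\dots$ of $L_z$, with probability at least $p$ over an infinite sequence $r_1,r_2,\dots$ of independent uniformly random bits, there is a finite $t^\star$ such that for all $t\ge t^\star$ the list $\mathcal A(x_1,r_1,\dots,x_t,r_t)$ identifies $L_z$. **Theorem.** $\mathcal C$ is $k$-list identifiable in the limit with probability $p$ on infinite draws if and only if $\mathcal C$ is probabilistically $k$-list identifiable in the limit with probability $p$. -/

import Mathlib

open MeasureTheory

noncomputable section

namespace ListIdentification

/-- The collection `C = (L_0, L_1, …)` of languages over the universe `U` is a sequence of sets
(repetitions are allowed, so finite collections are covered too).  The list `μ` of `k` indices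
identifies the language `L` if some index `i` in the list has `L_i = L`. -/
def Identifies {U : Type*} {k : ℕ} (C : ℕ → Set U) (L : Set U) (μ : Fin k → ℕ) : Prop :=
  ∃ j : Fin k, C (μ j) = L

/-- `x` is an enumeration of `L`: all its terms lie in `L` and every element of `L` occurs. -/
def IsEnumeration {U : Type*} (L : Set U) (x : ℕ → U) : Prop :=
  (∀ i, x i ∈ L) ∧ ∀ u ∈ L, ∃ i, x i = u

/-- A (deterministic) `k`-list identifier: a function `U^* → ℕ^k`. -/
abbrev ListIdentifier (U : Type*) (k : ℕ) : Type _ := List U → (Fin k → ℕ)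

/-- A probabilistic `k`-list identifier: a function `(U × {0,1})^* → ℕ^k`. -/
abbrev ProbListIdentifier (U : Type*) (k : ℕ) : Type _ := List (U × Bool) → (Fin k → ℕ)

/-- The finite prefix `(x_0, …, x_{t-1})` of length `t` of an infinite sequence. -/
def seqPrefix {α : Type*} (x : ℕ → α) (t : ℕ) : List α :=
  List.ofFn fun i : Fin t => x i

/-- On the infinite input `x`, the `k`-lists output by `A` on the prefixes of `x` all identify `L`
from some finite time on.  (Used with `α = U` and with `α = U × Bool`.) -/
def ConvergesTo {U α : Type*} {k : ℕ} (C : ℕ → Set U) (A : List α → (Fin k → ℕ))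
    (L : Set U) (x : ℕ → α) : Prop :=
  ∃ t₀ : ℕ, ∀ t ≥ t₀, Identifies C L (A (seqPrefix x t))

/-- A distribution `D` on `U` is valid for `L` if `D(x) > 0` exactly for the `x ∈ L`. -/
def IsValidFor {U : Type*} (D : PMF U) (L : Set U) : Prop :=
  ∀ x, 0 < D x ↔ x ∈ L

/-- The law `D^∞` of an infinite i.i.d. sequence drawn from `D`. -/
def iidDraws {U : Type*} [MeasurableSpace U] (D : PMF U) : Measure (ℕ → U) :=
  Measure.infinitePi fun _ : ℕ => D.toMeasure

/-- The law of an infinite sequence of independent uniformly random bits. -/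
def fairBits : Measure (ℕ → Bool) :=
  iidDraws (PMF.uniformOfFintype Bool)

/-- `A` identifies `C` in the limit with probability `p` on infinite draws. -/
def ListIdentifier.IdentifiesOnInfiniteDraws {U : Type*} [MeasurableSpace U] {k : ℕ}
    (A : ListIdentifier U k) (C : ℕ → Set U) (p : ℝ) : Prop :=
  ∀ z : ℕ, ∀ D : PMF U, IsValidFor D (C z) →
    ENNReal.ofReal p ≤ iidDraws D {x | ConvergesTo C A (C z) x}

/-- `A` identifies `C` in the limit with probability `p`: the enumeration is worst-case, and the
probability is over the random bits only. -/
def ProbListIdentifier.IdentifiesWithProb {U : Type*} {k : ℕ}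
    (A : ProbListIdentifier U k) (C : ℕ → Set U) (p : ℝ) : Prop :=
  ∀ z : ℕ, ∀ x : ℕ → U, IsEnumeration (C z) x →
    ENNReal.ofReal p ≤ fairBits {r | ConvergesTo C A (C z) fun i => (x i, r i)}

/-- `C` is `k`-list identifiable in the limit with probability `p` on infinite draws. -/
def ListIdentifiableOnInfiniteDraws {U : Type*} [MeasurableSpace U]
    (k : ℕ) (C : ℕ → Set U) (p : ℝ) : Prop :=
  ∃ A : ListIdentifier U k, A.IdentifiesOnInfiniteDraws C p

/-- `C` is probabilistically `k`-list identifiable in the limit with probability `p`. -/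
def ProbListIdentifiable {U : Type*} (k : ℕ) (C : ℕ → Set U) (p : ℝ) : Prop :=
  ∃ A : ProbListIdentifier U k, A.IdentifiesWithProb C p

end ListIdentification

end

namespace ListIdentification

open Measure Filter

/-! ### Online simulation from finite prefixes -/

section Prefixes

variable {α β U : Type*}

/-! Each model simulates the other. Given an enumeration of `L` and fair bits, picking the term at a
geometric random position gives a law with support exactly `L`; disjoint blocks of bits make the
picks i.i.d. Conversely, i.i.d. draws from a valid law almost surely enumerate `L`. The even draws
serve as the enumeration; the odd ones, independent of them, yield fair bits by von Neumann's trick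
(`map_vonNeumannBit`), and Fubini transfers the bound `p` (`le_iidDraws_splitDraws`). A singleton
`L` yields no randomness, so it is guessed while the sample is constant. Almost surely each
simulated term needs only a finite prefix, so `exists_prefix_simulation` turns both maps into
identifiers. -/

lemma seqPrefix_eq_iff {x y : ℕ → α} {t : ℕ} :
    seqPrefix x t = seqPrefix y t ↔ ∀ i < t, x i = y i := by
  simp only [seqPrefix, List.ofFn_inj, funext_iff, Fin.forall_iff]

@[simp] lemma length_seqPrefix (x : ℕ → α) (t : ℕ) : (seqPrefix x t).length = t := by
  simp [seqPrefix]

lemma mem_seqPrefix {x : ℕ → α} {t : ℕ} {a : α} : a ∈ seqPrefix x t ↔ ∃ i < t, x i = a := by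
  simp [seqPrefix, List.mem_ofFn, Fin.exists_iff]

/-- A map between sequence spaces each of whose output coordinates depends, on `G`, only on a finite
prefix of the input can be computed online: from longer and longer prefixes of the input one reads
off longer and longer prefixes of the output. -/
lemma exists_prefix_simulation (F : (ℕ → α) → ℕ → β) (G : Set (ℕ → α))
    (hF : ∀ x ∈ G, ∀ j, ∃ t : ℕ, ∀ y ∈ G, (∀ i < t, y i = x i) → F y j = F x j) :
    ∃ S : List α → List β, ∀ x ∈ G, ∀ m, ∃ t₀, ∀ t ≥ t₀, ∃ m' ≥ m,
      S (seqPrefix x t) = seqPrefix (F x) m' := by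
  classical
  let Det : List α → ℕ → Prop := fun w m => ∀ x ∈ G, ∀ y ∈ G,
    seqPrefix x w.length = w → seqPrefix y w.length = w → ∀ j < m, F x j = F y j
  refine ⟨fun w => if h : ∃ x ∈ G, seqPrefix x w.length = w then
    seqPrefix (F h.choose) (Nat.findGreatest (Det w) w.length) else [], fun x hx m => ?_⟩
  choose T hT using hF x hx
  -- The sum dominates every `T j` with `j < m`; the summand `m` keeps `m` within the search bound
  -- `w.length`.
  refine ⟨m + ∑ j ∈ Finset.range m, T j, fun t ht => ?_⟩
  have hex : ∃ y ∈ G, seqPrefix y (seqPrefix x t).length = seqPrefix x t := ⟨x, hx, by simp⟩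
  have hdet : Det (seqPrefix x t) m := by
    have key : ∀ y ∈ G, seqPrefix y (seqPrefix x t).length = seqPrefix x t →
        ∀ j < m, F y j = F x j := by
      intro y hy h j hj
      rw [length_seqPrefix, seqPrefix_eq_iff] at h
      refine hT j y hy fun i hi => h i ?_
      have := Finset.single_le_sum (f := T) (fun _ _ => Nat.zero_le _) (Finset.mem_range.2 hj)
      omega
    exact fun y hy y' hy' h h' j hj => (key y hy h j hj).trans (key y' hy' h' j hj).symm
  refine ⟨Nat.findGreatest (Det (seqPrefix x t)) (seqPrefix x t).length,
    Nat.le_findGreatest (by rw [length_seqPrefix]; omega) hdet, ?_⟩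
  dsimp only
  rw [dif_pos hex, seqPrefix_eq_iff]
  have h0 : Det (seqPrefix x t) 0 := fun _ _ _ _ _ _ j hj => absurd hj (Nat.not_lt_zero j)
  exact Nat.findGreatest_spec (P := Det (seqPrefix x t)) (Nat.zero_le _) h0 _ hex.choose_spec.1 x hx
    hex.choose_spec.2 (by simp)

/-- Convergence is a tail property, so the simulated prefix may lag or skip lengths as long as its
length tends to infinity. -/
lemma ConvergesTo.comp_simulation {k : ℕ} {C : ℕ → Set U} {A : List β → (Fin k → ℕ)} {L : Set U}
    {S : List α → List β} {x : ℕ → α} {y : ℕ → β} (h : ConvergesTo C A L y)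
    (hS : ∀ m, ∃ t₀, ∀ t ≥ t₀, ∃ m' ≥ m, S (seqPrefix x t) = seqPrefix y m') :
    ConvergesTo C (A ∘ S) L x := by
  obtain ⟨m, hm⟩ := h
  obtain ⟨t₀, ht₀⟩ := hS m
  refine ⟨t₀, fun t ht => ?_⟩
  obtain ⟨m', hm', e⟩ := ht₀ t ht
  rw [Function.comp_apply, e]
  exact hm m' hm'

lemma measurableSet_convergesTo [Countable α] [MeasurableSpace α] [DiscreteMeasurableSpace α]
    {k : ℕ} (C : ℕ → Set U) (A : List α → (Fin k → ℕ)) (L : Set U) :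
    MeasurableSet {x | ConvergesTo C A L x} := by
  simp only [ConvergesTo, Set.ofPred_exists, Set.ofPred_forall]
  refine .iUnion fun t₀ => .iInter fun t => .iInter fun _ => ?_
  have hm : Measurable fun (x : ℕ → α) (i : Fin t) => x i := by fun_prop
  exact hm (t := {v | Identifies C L (A (List.ofFn v))}) (Set.to_countable _).measurableSet

end Prefixes

/-! ### Rearranging i.i.d. sequences -/

section IID

variable {α : Type*} [MeasurableSpace α]

lemma ae_exists_mem_of_iid (ν : Measure α) [IsProbabilityMeasure ν] {S : Set α}
    (hS : MeasurableSet S) (h0 : ν S ≠ 0) :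
    ∀ᵐ x ∂infinitePi fun _ : ℕ => ν, ∃ n, x n ∈ S := by
  have hlt : ν Sᶜ < 1 := by
    rw [prob_compl_eq_one_sub hS]
    exact ENNReal.sub_lt_self ENNReal.one_ne_top one_ne_zero h0
  have hle (n : ℕ) : (infinitePi fun _ : ℕ => ν) {x | ¬ ∃ n, x n ∈ S} ≤ ν Sᶜ ^ n := by
    calc _ ≤ (infinitePi fun _ : ℕ => ν) (Set.pi (Finset.range n) fun _ => Sᶜ) :=
          measure_mono fun x (hx : ¬ ∃ n, x n ∈ S) i _ hi => hx ⟨i, hi⟩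
      _ = _ := by rw [infinitePi_pi _ fun _ _ => hS.compl]; simp
  exact le_antisymm (ge_of_tendsto' (ENNReal.tendsto_pow_atTop_nhds_zero_of_lt_one hlt) hle)
    zero_le

/-- Splitting an i.i.d. sequence along an injection `ι × κ → ℕ` gives an independent family of
i.i.d. sequences. -/
lemma map_iid_rows {ι κ : Type*} (ν : Measure α) [IsProbabilityMeasure ν] {e : ι → κ → ℕ}
    (he : Function.Injective fun q : ι × κ => e q.1 q.2) :
    (infinitePi fun _ : ℕ => ν).map (fun x j n => x (e j n)) =
      infinitePi fun _ : ι => infinitePi fun _ : κ => ν := by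
  rw [← infinitePi_map_curry fun (_ : ι) (_ : κ) => ν,
    ← map_infinitePi_infinitePi_of_inj (P := fun _ : ℕ => ν) he,
    map_map (by fun_prop) (by fun_prop)]
  rfl

lemma strictMono_pair (j : ℕ) : StrictMono (Nat.pair j) := fun _ _ h => Nat.pair_lt_pair_right j h

lemma injective_pair : Function.Injective fun q : ℕ × ℕ => Nat.pair q.1 q.2 :=
  Nat.pairEquiv.injective

lemma map_iid_blocks {β : Type*} [MeasurableSpace β] (ν : Measure α) [IsProbabilityMeasure ν]
    {f : (ℕ → α) → β} (hf : Measurable f) :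
    (infinitePi fun _ : ℕ => ν).map (fun x j => f fun n => x (Nat.pair j n)) =
      infinitePi fun _ : ℕ => (infinitePi fun _ : ℕ => ν).map f := by
  rw [← infinitePi_map_pi _ fun _ => hf, ← map_iid_rows ν injective_pair,
    map_map (by fun_prop) (by fun_prop)]
  rfl

lemma map_iid_even_odd (ν : Measure α) [IsProbabilityMeasure ν] :
    (infinitePi fun _ : ℕ => ν).map (fun x => (fun j => x (2 * j), fun j => x (2 * j + 1))) =
      (infinitePi fun _ : ℕ => ν).prod (infinitePi fun _ : ℕ => ν) := by
  have he : Function.Injective fun q : Bool × ℕ => 2 * q.2 + q.1.toNat := by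
    rintro ⟨b, a⟩ ⟨b', a'⟩ h
    cases b <;> cases b' <;> simp at h ⊢ <;> omega
  rw [← infinitePi_map_eval_prod (P := fun _ : Bool => infinitePi fun _ : ℕ => ν)
    Bool.false_ne_true, ← map_iid_rows (e := fun (b : Bool) n => 2 * n + b.toNat) ν he,
    map_map (by fun_prop) (by fun_prop)]
  rfl

lemma ae_iid_rows {ι : Type*} [Countable ι] (ν : Measure α) [IsProbabilityMeasure ν]
    {e : ι → ℕ → ℕ} (he : ∀ j, Function.Injective (e j)) {P : (ℕ → α) → Prop}
    (h : ∀ᵐ x ∂infinitePi fun _ : ℕ => ν, P x) :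
    ∀ᵐ x ∂infinitePi fun _ : ℕ => ν, ∀ j, P fun n => x (e j n) := by
  refine ae_all_iff.2 fun j => ?_
  have hm : Measurable fun (x : ℕ → α) n => x (e j n) := by fun_prop
  refine ae_of_ae_map hm.aemeasurable ?_
  rwa [map_infinitePi_infinitePi_of_inj (P := fun _ : ℕ => ν) (he j)]

end IID

/-! ### Position of the first success -/

section FirstSuccess

/-- The index of the first `true` in a sequence of bits. -/
noncomputable def firstTrue (r : ℕ → Bool) : ℕ := sInf {n | r n = true}

lemma firstTrue_eq {r : ℕ → Bool} {n : ℕ} (h : r n = true) (h' : ∀ m < n, r m = false) :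
    firstTrue r = n := by
  refine le_antisymm (Nat.sInf_le h) (not_lt.1 fun hlt => ?_)
  have h₁ : r (firstTrue r) = true := Nat.sInf_mem (s := {n | r n = true}) ⟨n, h⟩
  simp [h' _ hlt] at h₁

lemma firstTrue_spec {r : ℕ → Bool} (h : ∃ n, r n = true) :
    r (firstTrue r) = true ∧ ∀ m < firstTrue r, r m = false :=
  ⟨Nat.sInf_mem (s := {n | r n = true}) h, fun m hm => by simpa using Nat.notMem_of_lt_sInf hm⟩

lemma firstTrue_congr {r s : ℕ → Bool} (h : ∃ n, r n = true)
    (hrs : ∀ n ≤ firstTrue r, s n = r n) : firstTrue s = firstTrue r := by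
  obtain ⟨h₁, h₂⟩ := firstTrue_spec h
  exact firstTrue_eq ((hrs _ le_rfl).trans h₁) fun m hm => (hrs m hm.le).trans (h₂ m hm)

lemma measurable_firstTrue : Measurable firstTrue := by
  refine measurable_to_countable' fun n => ?_
  have hb (m : ℕ) (b : Bool) : MeasurableSet {r : ℕ → Bool | r m = b} :=
    measurableSet_eq_fun (measurable_pi_apply m) measurable_const
  -- The second piece is the all-false sequence, where `sInf ∅ = 0`.
  have : firstTrue ⁻¹' {n} = ({r | r n = true} ∩ ⋂ m, ⋂ _ : m < n, {r | r m = false}) ∪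
      ({_r | n = 0} ∩ ⋂ m, {r : ℕ → Bool | r m = false}) := by
    ext r
    simp only [Set.mem_preimage, Set.mem_singleton_iff, Set.mem_union, Set.mem_inter_iff,
      Set.mem_ofPred_eq, Set.mem_iInter]
    constructor
    · rintro rfl
      by_cases h : ∃ n, r n = true
      · exact .inl (firstTrue_spec h)
      · have h' : ∀ m, r m = false := by simpa using h
        exact .inr ⟨by simp [firstTrue, h'], h'⟩
    · rintro (⟨h, h'⟩ | ⟨rfl, h⟩)
      · exact firstTrue_eq h h'
      · simp [firstTrue, h]
  rw [this]
  exact ((hb _ _).inter (.iInter fun m => .iInter fun _ => hb _ _)).union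
    ((MeasurableSet.const _).inter (.iInter fun m => hb _ _))

instance : IsProbabilityMeasure fairBits := by unfold fairBits iidDraws; infer_instance

lemma uniform_bool_singleton (b : Bool) :
    (PMF.uniformOfFintype Bool).toMeasure {b} = 2⁻¹ := by
  rw [PMF.toMeasure_apply_singleton _ _ (measurableSet_singleton b)]
  simp

lemma fairBits_firstTrue_ne_zero (n : ℕ) : fairBits (firstTrue ⁻¹' {n}) ≠ 0 := by
  have hle : fairBits (Set.pi (Finset.range (n + 1)) fun m => {decide (m = n)}) ≤
      fairBits (firstTrue ⁻¹' {n}) := by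
    refine measure_mono fun r hr => ?_
    simp only [Set.mem_pi, Finset.coe_range, Set.mem_Iio, Set.mem_singleton_iff] at hr
    refine firstTrue_eq ?_ fun m hm => ?_
    · simpa using hr n (by omega)
    · simpa [hm.ne] using hr m (by omega)
  refine (lt_of_lt_of_le ?_ hle).ne'
  rw [fairBits, iidDraws, infinitePi_pi _ fun _ _ => measurableSet_singleton _]
  simp only [uniform_bool_singleton, Finset.prod_const]
  exact ENNReal.pow_pos (by simp) _

lemma ae_fairBits_exists_true : ∀ᵐ r ∂fairBits, ∃ n, r n = true := by
  have := ae_exists_mem_of_iid (PMF.uniformOfFintype Bool).toMeasure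
    (measurableSet_singleton true) (by rw [uniform_bool_singleton]; simp)
  simp only [Set.mem_singleton_iff] at this
  exact this

end FirstSuccess

/-! ### From enumeration and bits to i.i.d. draws -/

section Derandomized

variable {U : Type*} [Countable U] [MeasurableSpace U] [DiscreteMeasurableSpace U]

/-- The distribution of the term of `x` at the position of the first `true` among fair bits. -/
noncomputable def geometricSample (x : ℕ → U) : PMF U :=
  haveI : IsProbabilityMeasure (fairBits.map fun r => x (firstTrue r)) :=
    isProbabilityMeasure_map (Measurable.of_discrete.comp measurable_firstTrue).aemeasurable
  (fairBits.map fun r => x (firstTrue r)).toPMF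

lemma toMeasure_geometricSample (x : ℕ → U) :
    (geometricSample x).toMeasure = fairBits.map fun r => x (firstTrue r) := by
  have : IsProbabilityMeasure (fairBits.map fun r => x (firstTrue r)) :=
    isProbabilityMeasure_map (Measurable.of_discrete.comp measurable_firstTrue).aemeasurable
  exact toPMF_toMeasure _

lemma isValidFor_geometricSample {L : Set U} {x : ℕ → U} (hx : IsEnumeration L x) :
    IsValidFor (geometricSample x) L := by
  have hm : Measurable fun r => x (firstTrue r) := Measurable.of_discrete.comp measurable_firstTrue
  intro u
  rw [← PMF.toMeasure_apply_singleton _ _ (measurableSet_singleton u), toMeasure_geometricSample,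
    map_apply hm (measurableSet_singleton u)]
  constructor
  · intro h
    obtain ⟨r, hr⟩ := nonempty_of_measure_ne_zero h.ne'
    exact Set.mem_singleton_iff.1 hr ▸ hx.1 _
  · intro h
    obtain ⟨i, rfl⟩ := hx.2 u h
    refine (pos_iff_ne_zero.2 (fairBits_firstTrue_ne_zero i)).trans_le (measure_mono fun r hr => ?_)
    simp [Set.mem_singleton_iff.1 hr]

/-- From an enumeration and fair bits one obtains i.i.d. draws from a valid distribution: the `j`-th
draw is the term of the enumeration at the first success in the `j`-th block of bits. -/
theorem probListIdentifiable_of_onInfiniteDraws {k : ℕ} {C : ℕ → Set U} {p : ℝ}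
    (h : ListIdentifiableOnInfiniteDraws k C p) : ProbListIdentifiable k C p := by
  obtain ⟨A, hA⟩ := h
  let N : (ℕ → Bool) → ℕ → ℕ := fun r j => firstTrue fun n => r (Nat.pair j n)
  let G : Set (ℕ → U × Bool) := {z | ∀ j, ∃ n, (z (Nat.pair j n)).2 = true}
  obtain ⟨S, hS⟩ := exists_prefix_simulation (fun z j => (z (N (fun i => (z i).2) j)).1) G
    fun z hz j => by
      let r : ℕ → Bool := fun i => (z i).2
      -- Long enough to contain both the selected term and the bits of block `j` up to its first
      -- success.
      refine ⟨N r j + Nat.pair j (N r j) + 1, fun y hy hyz => ?_⟩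
      have : N (fun i => (y i).2) j = N r j := by
        refine firstTrue_congr (hz j) fun n hn => ?_
        have hle : Nat.pair j n ≤ Nat.pair j (N r j) := (strictMono_pair j).monotone hn
        exact congrArg Prod.snd (hyz _ (by omega))
      simp only [this]
      rw [hyz _ (by omega)]
  refine ⟨A ∘ S, fun z x hx => ?_⟩
  refine (hA z _ (isValidFor_geometricSample hx)).trans ?_
  have hm : Measurable fun r => x (firstTrue r) := Measurable.of_discrete.comp measurable_firstTrue
  have hlaw : iidDraws (geometricSample x) = fairBits.map fun r j => x (N r j) := by
    rw [iidDraws, toMeasure_geometricSample]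
    exact (map_iid_blocks _ hm).symm
  have hm' : Measurable fun r j => x (N r j) :=
    measurable_pi_lambda _ fun j => hm.comp (by fun_prop : Measurable fun (r : ℕ → Bool) n =>
      r (Nat.pair j n))
  rw [hlaw, map_apply hm' (measurableSet_convergesTo _ _ _)]
  refine measure_mono_ae ?_
  filter_upwards [ae_iid_rows _ (fun j => (strictMono_pair j).injective)
    ae_fairBits_exists_true] with r hr hc
  exact ConvergesTo.comp_simulation hc (hS (fun i => (x i, r i)) hr)

end Derandomized

/-! ### Extracting fair bits from draws -/

section VonNeumann

variable {U : Type*}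

/-- Von Neumann's extractor: compare the entries of the first pair `(r (2n), r (2n + 1))` with
distinct entries. -/
noncomputable def vonNeumannBit (c : U → ℕ) (r : ℕ → U) : Bool :=
  open Classical in
  decide (∃ n, c (r (2 * n)) < c (r (2 * n + 1)) ∧ ∀ m < n, c (r (2 * m)) = c (r (2 * m + 1)))

lemma vonNeumannBit_eq {c : U → ℕ} {r : ℕ → U} {n : ℕ}
    (hn : c (r (2 * n)) ≠ c (r (2 * n + 1)))
    (h : ∀ m < n, c (r (2 * m)) = c (r (2 * m + 1))) :
    vonNeumannBit c r = decide (c (r (2 * n)) < c (r (2 * n + 1))) := by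
  refine decide_eq_decide.2 ⟨fun ⟨m, hm, hm'⟩ => ?_, fun hlt => ⟨n, hlt, h⟩⟩
  rcases lt_trichotomy m n with hmn | rfl | hmn
  · exact absurd (h m hmn) hm.ne
  · exact hm
  · exact absurd (hm' n hmn) hn

lemma exists_first_distinct {c : U → ℕ} {r : ℕ → U}
    (h : ∃ n, c (r (2 * n)) ≠ c (r (2 * n + 1))) :
    ∃ n, c (r (2 * n)) ≠ c (r (2 * n + 1)) ∧ ∀ m < n, c (r (2 * m)) = c (r (2 * m + 1)) := by
  classical
  exact ⟨Nat.find h, Nat.find_spec h, fun m hm => not_not.1 (Nat.find_min h hm)⟩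

/-- The involution of `ℕ` exchanging `2n` and `2n + 1`. -/
def swapPairs (i : ℕ) : ℕ := if i % 2 = 0 then i + 1 else i - 1

lemma swapPairs_even (n : ℕ) : swapPairs (2 * n) = 2 * n + 1 := by simp [swapPairs]

lemma swapPairs_odd (n : ℕ) : swapPairs (2 * n + 1) = 2 * n := by simp [swapPairs, Nat.add_mod]

lemma swapPairs_injective : Function.Injective swapPairs := by
  intro a b h
  simp only [swapPairs] at h
  split_ifs at h <;> omega

/-- Exchanging the entries within every pair keeps the first distinct pair in place and reverses its
comparison. -/
lemma vonNeumannBit_swap {c : U → ℕ} {r : ℕ → U}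
    (h : ∃ n, c (r (2 * n)) ≠ c (r (2 * n + 1))) :
    vonNeumannBit c (fun i => r (swapPairs i)) = !vonNeumannBit c r := by
  obtain ⟨n, hn, hlt⟩ := exists_first_distinct h
  rw [vonNeumannBit_eq hn hlt, vonNeumannBit_eq (n := n)]
  · simp only [swapPairs_even, swapPairs_odd]
    rw [← decide_not, decide_eq_decide]
    omega
  · simpa only [swapPairs_even, swapPairs_odd] using hn.symm
  · intro m hm
    simpa only [swapPairs_even, swapPairs_odd] using (hlt m hm).symm

/-- The bits extracted from the successive blocks of a sequence of draws. -/
noncomputable def extractedBits (c : U → ℕ) (x : ℕ → U) (j : ℕ) : Bool :=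
  vonNeumannBit c fun n => x (Nat.pair j n)

/-- Draws with even index serve as the enumeration, those with odd index as the source of bits. -/
noncomputable def splitDraws (c : U → ℕ) (x : ℕ → U) (j : ℕ) : U × Bool :=
  (x (2 * j), extractedBits c (fun n => x (2 * n + 1)) j)

lemma exists_splitDraws_simulation (c : U → ℕ) :
    ∃ S : List U → List (U × Bool), ∀ x : ℕ → U,
      (∀ j, ∃ n, c (x (2 * Nat.pair j (2 * n) + 1)) ≠ c (x (2 * Nat.pair j (2 * n + 1) + 1))) →
      ∀ m, ∃ t₀, ∀ t ≥ t₀, ∃ m' ≥ m, S (seqPrefix x t) = seqPrefix (splitDraws c x) m' := by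
  refine exists_prefix_simulation (splitDraws c) {x | ∀ j, ∃ n,
    c (x (2 * Nat.pair j (2 * n) + 1)) ≠ c (x (2 * Nat.pair j (2 * n + 1) + 1))} fun x hx j => ?_
  obtain ⟨n, hn, hlt⟩ := exists_first_distinct (r := fun i => x (2 * Nat.pair j i + 1)) (hx j)
  -- Covers the even draw `2 * j` and the odd draws of block `j` through its first distinct pair.
  refine ⟨2 * j + 2 * Nat.pair j (2 * n + 1) + 2, fun y _ hyx => ?_⟩
  have hxy (i : ℕ) (hi : i ≤ 2 * n + 1) :
      y (2 * Nat.pair j i + 1) = x (2 * Nat.pair j i + 1) := by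
    have := (strictMono_pair j).monotone hi
    exact hyx _ (by omega)
  refine Prod.ext (hyx _ (by omega)) ?_
  simp only [splitDraws, extractedBits]
  refine (vonNeumannBit_eq (n := n) ?_ fun m hm => ?_).trans ?_
  · rw [hxy _ (by omega), hxy _ le_rfl]
    exact hn
  · rw [hxy _ (by omega), hxy _ (by omega)]
    exact hlt m hm
  · rw [hxy _ (by omega), hxy _ le_rfl]
    exact (vonNeumannBit_eq (r := fun i => x (2 * Nat.pair j i + 1)) hn hlt).symm

variable [MeasurableSpace U] [DiscreteMeasurableSpace U]

lemma measurable_vonNeumannBit (c : U → ℕ) : Measurable (vonNeumannBit c) := by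
  refine measurable_to_bool ?_
  have hc (i : ℕ) : Measurable fun r : ℕ → U => c (r i) :=
    Measurable.of_discrete.comp (measurable_pi_apply i)
  have : vonNeumannBit c ⁻¹' {true} = ⋃ n, ({r | c (r (2 * n)) < c (r (2 * n + 1))} ∩
      ⋂ m, ⋂ _ : m < n, {r | c (r (2 * m)) = c (r (2 * m + 1))}) := by
    ext r
    simp [vonNeumannBit]
  rw [this]
  exact .iUnion fun n => (measurableSet_lt (hc _) (hc _)).inter
    (.iInter fun m => .iInter fun _ => measurableSet_eq_fun (hc _) (hc _))

lemma measurable_extractedBits (c : U → ℕ) : Measurable (extractedBits c) :=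
  measurable_pi_lambda _ fun j => (measurable_vonNeumannBit c).comp
    (by fun_prop : Measurable fun (x : ℕ → U) n => x (Nat.pair j n))

variable [Countable U]

lemma ae_exists_distinct_pair {D : PMF U} {c : U → ℕ} {u v : U} (hu : 0 < D u) (hv : 0 < D v)
    (huv : c u ≠ c v) :
    ∀ᵐ r ∂iidDraws D, ∃ n, c (r (2 * n)) ≠ c (r (2 * n + 1)) := by
  have he : Function.Injective fun q : ℕ × Bool => 2 * q.1 + q.2.toNat := by
    rintro ⟨a, b⟩ ⟨a', b'⟩ h
    cases b <;> cases b' <;> simp at h ⊢ <;> omega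
  have hrows := map_iid_rows (e := fun n (b : Bool) => 2 * n + b.toNat) D.toMeasure he
  have hpos : (infinitePi fun _ : Bool => D.toMeasure) {fun b => cond b v u} ≠ 0 := by
    rw [infinitePi_singleton_of_fintype, Fintype.prod_bool]
    simp only [PMF.toMeasure_apply_singleton _ _ (measurableSet_singleton _), cond_true, cond_false]
    exact mul_ne_zero hv.ne' hu.ne'
  have := ae_exists_mem_of_iid _ (measurableSet_singleton _) hpos
  rw [← hrows] at this
  have hm : Measurable fun (r : ℕ → U) n (b : Bool) => r (2 * n + b.toNat) := by fun_prop
  filter_upwards [ae_of_ae_map hm.aemeasurable this] with r ⟨n, hn⟩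
  have h₀ : r (2 * n) = u := congrFun hn false
  have h₁ : r (2 * n + 1) = v := congrFun hn true
  exact ⟨n, by rwa [h₀, h₁]⟩

/-- Swapping within pairs preserves the i.i.d. law but almost surely negates the bit, so both values
are equally likely. -/
lemma map_vonNeumannBit {D : PMF U} {c : U → ℕ} {u v : U} (hu : 0 < D u) (hv : 0 < D v)
    (huv : c u ≠ c v) :
    (iidDraws D).map (vonNeumannBit c) = (PMF.uniformOfFintype Bool).toMeasure := by
  have hm := measurable_vonNeumannBit c
  have hprob : IsProbabilityMeasure ((iidDraws D).map (vonNeumannBit c)) := by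
    have : IsProbabilityMeasure (iidDraws D) := by unfold iidDraws; infer_instance
    exact isProbabilityMeasure_map hm.aemeasurable
  have hswap : (iidDraws D).map (vonNeumannBit c) =
      ((iidDraws D).map (vonNeumannBit c)).map (fun b => !b) := by
    conv_lhs => rw [iidDraws, ← map_infinitePi_infinitePi_of_inj
      (P := fun _ : ℕ => D.toMeasure) swapPairs_injective]
    rw [map_map hm (by fun_prop), map_map .of_discrete hm]
    refine map_congr ?_
    filter_upwards [ae_exists_distinct_pair hu hv huv] with r hr using vonNeumannBit_swap hr
  have htf : (iidDraws D).map (vonNeumannBit c) {true} =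
      (iidDraws D).map (vonNeumannBit c) {false} := by
    conv_lhs => rw [hswap, map_apply .of_discrete (measurableSet_singleton _)]
    congr 1
    ext b
    simp
  have hsum : (iidDraws D).map (vonNeumannBit c) {true} +
      (iidDraws D).map (vonNeumannBit c) {false} = 1 := by
    rw [← measure_union (by simp) (measurableSet_singleton _), ← measure_univ
      (μ := (iidDraws D).map (vonNeumannBit c))]
    congr 1
    ext b
    cases b <;> simp
  have half : (iidDraws D).map (vonNeumannBit c) {false} = 2⁻¹ := by
    rw [htf, ← two_mul] at hsum
    exact ENNReal.eq_inv_of_mul_eq_one_left (by rwa [mul_comm])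
  refine ext_of_singleton fun b => ?_
  rw [uniform_bool_singleton]
  cases b
  · exact half
  · exact htf.trans half

end VonNeumann

/-! ### From i.i.d. draws to enumeration and bits -/

section Randomized

variable {U : Type*} [MeasurableSpace U]

instance (D : PMF U) : IsProbabilityMeasure (iidDraws D) := by unfold iidDraws; infer_instance

variable [Countable U] [DiscreteMeasurableSpace U]

lemma ae_forall_mem {D : PMF U} {L : Set U} (hD : IsValidFor D L) :
    ∀ᵐ x ∂iidDraws D, ∀ i, x i ∈ L := by
  refine ae_all_iff.2 fun i => ?_
  refine ae_of_ae_map (measurable_pi_apply i).aemeasurable ?_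
  rw [iidDraws, infinitePi_map_eval]
  refine (D.toMeasure_apply_eq_zero_iff (Set.to_countable _).measurableSet).2 ?_
  exact Set.disjoint_left.2 fun x hx hx' => hx' ((hD x).1 (pos_iff_ne_zero.2 hx))

lemma ae_exists_eq {D : PMF U} {u : U} (hu : 0 < D u) : ∀ᵐ x ∂iidDraws D, ∃ i, x i = u :=
  ae_exists_mem_of_iid _ (measurableSet_singleton u)
    (by rw [PMF.toMeasure_apply_singleton _ _ (measurableSet_singleton u)]; exact hu.ne')

lemma ae_isEnumeration {D : PMF U} {L : Set U} (hD : IsValidFor D L) :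
    ∀ᵐ x ∂iidDraws D, IsEnumeration L x := by
  have h : ∀ᵐ x ∂iidDraws D, ∀ u, u ∈ L → ∃ i, x i = u := by
    refine ae_all_iff.2 fun u => ?_
    by_cases hu : u ∈ L
    · filter_upwards [ae_exists_eq ((hD u).2 hu)] with x hx _ using hx
    · simp [hu]
  filter_upwards [ae_forall_mem hD, h] with x h₁ h₂ using ⟨h₁, h₂⟩

lemma map_extractedBits {D : PMF U} {c : U → ℕ} {u v : U} (hu : 0 < D u) (hv : 0 < D v)
    (huv : c u ≠ c v) : (iidDraws D).map (extractedBits c) = fairBits := by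
  refine (map_iid_blocks _ (measurable_vonNeumannBit c)).trans ?_
  rw [fairBits, iidDraws, ← map_vonNeumannBit hu hv huv, iidDraws]

lemma le_iidDraws_splitDraws {k : ℕ} {C : ℕ → Set U} {p : ℝ} {A : ProbListIdentifier U k}
    (hA : A.IdentifiesWithProb C p) {z : ℕ} {D : PMF U} (hD : IsValidFor D (C z)) {c : U → ℕ}
    {u v : U} (hu : u ∈ C z) (hv : v ∈ C z) (huv : c u ≠ c v) :
    ENNReal.ofReal p ≤ iidDraws D {x | ConvergesTo C A (C z) (splitDraws c x)} := by
  have hbits := measurable_extractedBits c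
  have hzip : Measurable fun (q : (ℕ → U) × (ℕ → U)) j => (q.1 j, extractedBits c q.2 j) :=
    measurable_pi_lambda _ fun j => (measurable_pi_apply j |>.comp measurable_fst).prodMk
      (measurable_pi_apply j |>.comp (hbits.comp measurable_snd))
  have hconv := measurableSet_convergesTo C A (C z)
  have hT : MeasurableSet {q : (ℕ → U) × (ℕ → U) |
      ConvergesTo C A (C z) fun j => (q.1 j, extractedBits c q.2 j)} := hzip hconv
  have hsplit : iidDraws D {x | ConvergesTo C A (C z) (splitDraws c x)} =
      ((iidDraws D).prod (iidDraws D))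
        {q : (ℕ → U) × (ℕ → U) |
          ConvergesTo C A (C z) fun j => (q.1 j, extractedBits c q.2 j)} := by
    rw [iidDraws, ← map_iid_even_odd, map_apply (by fun_prop) hT]
    rfl
  rw [hsplit, prod_apply hT]
  have hfib : ∀ᵐ e ∂iidDraws D, ENNReal.ofReal p ≤ iidDraws D (Prod.mk e ⁻¹'
      {q : (ℕ → U) × (ℕ → U) | ConvergesTo C A (C z) fun j => (q.1 j, extractedBits c q.2 j)}) := by
    filter_upwards [ae_isEnumeration hD] with e he
    refine (hA z e he).trans (le_of_eq ?_)
    have hm : Measurable fun (r : ℕ → Bool) i => (e i, r i) := by fun_prop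
    have hS : MeasurableSet {r : ℕ → Bool | ConvergesTo C A (C z) fun i => (e i, r i)} := hm hconv
    rw [← map_extractedBits ((hD u).2 hu) ((hD v).2 hv) huv, map_apply hbits hS]
    rfl
  simpa using lintegral_mono_ae hfib

/-- While the sample is constant, guess a fixed singleton language; afterwards, simulate the
probabilistic identifier on the enumeration and the bits extracted from the draws. -/
theorem onInfiniteDraws_of_probListIdentifiable {k : ℕ} {C : ℕ → Set U} (hC : ∀ i, (C i).Nonempty)
    {p : ℝ} (hp : p ≤ 1) (h : ProbListIdentifiable k C p) :
    ListIdentifiableOnInfiniteDraws k C p := by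
  classical
  obtain ⟨A, hA⟩ := h
  obtain ⟨c, hc⟩ := exists_injective_nat U
  obtain ⟨S, hS⟩ := exists_splitDraws_simulation c
  let B : ListIdentifier U k := fun w =>
    if h : ∃ i, ∃ u, C i = {u} ∧ ∀ v ∈ w, v = u then fun _ => h.choose else A (S w)
  refine ⟨B, fun z D hD => ?_⟩
  -- An empty list identifies nothing, so for `k = 0` the assumption on `A` already forces
  -- `ENNReal.ofReal p = 0`.
  rcases k.eq_zero_or_pos with rfl | hk
  · obtain ⟨x, hx⟩ := (ae_isEnumeration hD).exists
    refine (hA z x hx).trans ?_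
    have : {r : ℕ → Bool | ConvergesTo C A (C z) fun i => (x i, r i)} = ∅ :=
      Set.eq_empty_of_forall_notMem fun r ⟨t, ht⟩ => (ht t le_rfl).choose.elim0
    rw [this, measure_empty]
    exact zero_le
  rcases (hC z).exists_eq_singleton_or_nontrivial with ⟨u, hu⟩ | ⟨u, hu, v, hv, huv⟩
  · have hae : ∀ᵐ x ∂iidDraws D, ConvergesTo C B (C z) x := by
      filter_upwards [ae_forall_mem hD] with x hx
      simp only [hu, Set.mem_singleton_iff] at hx
      -- One draw pins down the guessed singleton; the empty sample fits any.
      refine ⟨1, fun t ht => ⟨⟨0, hk⟩, ?_⟩⟩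
      have hex : ∃ i, ∃ u, C i = {u} ∧ ∀ v ∈ seqPrefix x t, v = u := by
        refine ⟨z, u, hu, fun v hv => ?_⟩
        obtain ⟨i, -, rfl⟩ := mem_seqPrefix.1 hv
        exact hx i
      simp only [B, dif_pos hex]
      obtain ⟨u', hu', hall⟩ := hex.choose_spec
      rw [hu', hu, ← hall _ (mem_seqPrefix.2 ⟨0, ht, rfl⟩), hx 0]
    have hone : iidDraws D {x | ConvergesTo C B (C z) x} = 1 :=
      (prob_compl_eq_zero_iff (measurableSet_convergesTo C B (C z))).1 hae
    rw [hone]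
    exact ENNReal.ofReal_le_one.2 hp
  · refine (le_iidDraws_splitDraws hA hD hu hv (hc.ne huv)).trans (measure_mono_ae ?_)
    have hu' := (hD u).2 hu
    have hv' := (hD v).2 hv
    have hinj (j : ℕ) : Function.Injective fun n => 2 * Nat.pair j n + 1 := fun a b hab =>
      (strictMono_pair j).injective (by simpa using hab)
    filter_upwards [ae_exists_eq hu', ae_exists_eq hv',
      ae_iid_rows _ hinj (ae_exists_distinct_pair hu' hv' (hc.ne huv))]
      with x ⟨i, hi⟩ ⟨j, hj⟩ hx hconv
    obtain ⟨t₀, ht₀⟩ := ConvergesTo.comp_simulation hconv (hS x hx)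
    -- By then both `u` and `v` have been drawn, which rules out the singleton guess.
    refine ⟨t₀ + i + j + 1, fun t ht => ?_⟩
    have hnex : ¬ ∃ i, ∃ u, C i = {u} ∧ ∀ v ∈ seqPrefix x t, v = u := by
      rintro ⟨-, w, -, hw⟩
      have h₁ := hw _ (mem_seqPrefix.2 ⟨i, by omega, hi⟩)
      have h₂ := hw _ (mem_seqPrefix.2 ⟨j, by omega, hj⟩)
      exact huv (h₁.trans h₂.symm)
    simp only [B, dif_neg hnex]
    exact ht₀ t (by omega)

end Randomized

end ListIdentification

theorem mainTheorem5 {U : Type*} [Countable U] [MeasurableSpace U] [DiscreteMeasurableSpace U]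
    (k : ℕ) (C : ℕ → Set U) (hC : ∀ i, (C i).Nonempty)
    (p : ℝ) (hp : p ∈ Set.Icc (0 : ℝ) 1) :
    ListIdentification.ListIdentifiableOnInfiniteDraws k C p ↔
      ListIdentification.ProbListIdentifiable k C p :=
  ⟨ListIdentification.probListIdentifiable_of_onInfiniteDraws,
    ListIdentification.onInfiniteDraws_of_probListIdentifiable hC hp.2⟩
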